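/- Let $n \ge 1$, let $\mathbb{R}^n_+ = \{z \in \mathbb{R}^n : z_i \ge 0 \text{ for all } i\}$ and let $M^n = \{x \in \mathbb{R}^n_+ : \sum_{i=1}^n x_i = 1\}$ be the price simplex. For a nonempty compact set $A \subseteq \mathbb{R}^n$ and $y \in \mathbb{R}^n$ write $\sigma(A,y) = \sup_{z \in A} \langle z, y\rangle$. For a convex set $V \subseteq \mathbb{R}^n$, a subset $U \subseteq V$ is called self segment-dense in $V$ if $U$ is dense in $V$ and, for all $x, y \in U$, the set $[x,y] \cap U$ is dense in the closed line segment $[x,y]$. Let $C : M^n \rightrightarrows \mathbb{R}^n$ be a set-valued map with nonempty compact convex values, and let $D \subseteq M^n$ be self segment-dense in $M^n$. Assume that (i) for every $y \in D$, the function $x \mapsto \sigma(C(x), y)$ is upper semicontinuous on $M^n$; (ii) (Walras' law on $D$) $\sigma(C(x), x) \ge 0$ for every $x \in D$. Then there exists $x_0 \in M^n$ such that $C(x_0) \cap \mathbb{R}^n_+ \ne \emptyset$. -/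

import Mathlib

/-- `U` is self segment-dense in the convex set `V`: `U ⊆ V`, `U` is dense in `V`, and for all
`x, y ∈ U` the set `[x, y] ∩ U` is dense in the closed segment `[x, y]`. -/
structure IsSelfSegmentDense {X : Type*} [AddCommGroup X] [Module ℝ X] [TopologicalSpace X]
    (U V : Set X) : Prop where
  convex : Convex ℝ V
  subset : U ⊆ V
  dense : V ⊆ closure U
  segment_dense : ∀ x ∈ U, ∀ y ∈ U, segment ℝ x y ⊆ closure (segment ℝ x y ∩ U)

/-- The support function `σ(A, y) = sup_{z ∈ A} ⟨z, y⟩` of a set `A ⊆ ℝⁿ`. The real supremum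
is the genuine one whenever `A` is nonempty and bounded, in particular nonempty and compact. -/
noncomputable def supportFn {n : ℕ} (A : Set (Fin n → ℝ)) (y : Fin n → ℝ) : ℝ :=
  sSup ((fun z : Fin n → ℝ => z ⬝ᵥ y) '' A)

/-! For `y ∈ D` let `G y` be the set of `x` with `σ(C(x), y) ≥ 0`, closed by (i). A point `x₀`
common to all `G y` suffices: `σ(C(x₀), ·) ≥ 0` passes from `D` to its closure, hence to the whole
simplex, whereas a `C(x₀)` missing the orthant could be strictly separated from it by a price with
`σ < 0`.

By compactness only finitely many `y i ∈ D` need a common point. Walras' law and linearity put each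
point of `D` in the hull of some of the `y i` into the `G` of one of them. Self segment-density
makes `D` dense in that hull, and a finite union of closed sets is closed, so the hull is covered.
This is the KKM hypothesis.

KKM comes from Scarf's lemma, a parity count, applied to ever finer lattices in the simplex. -/

/-! ### Dominant sets and Scarf's lemma -/

/-- `S` is dominant for a family of rankings `p` if no point beats, in every ranking, some
member of `S`. -/
def Dominant {E I L : Type*} [LinearOrder L] (p : I → E → L) (S : Finset E) : Prop :=
  ∀ x, ∃ j, ∀ s ∈ S, p j x ≤ p j s

namespace Dominant

variable {E I L : Type*} [LinearOrder L] {p : I → E → L}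

theorem mono {S T : Finset E} (hS : Dominant p S) (hTS : T ⊆ S) : Dominant p T := fun x =>
  (hS x).imp fun _ hj s hs => hj s (hTS hs)

variable [Fintype E] [DecidableEq E] [Fintype I] [DecidableEq I]

/-- A nonempty dominant set with one element less than there are rankings can be completed in
exactly two ways. -/
theorem exists_two_completions (hp : ∀ j, Function.Injective (p j)) {T : Finset E}
    (hT : Dominant p T) (hne : T.Nonempty) (hcard : T.card + 1 = Fintype.card I)
    (hA : ∀ j, ∃ e, ∀ i ≠ j, ∃ t ∈ T, p i t < p i e) :
    ∃ e₁ e₂, e₁ ≠ e₂ ∧ ∀ e, (e ∉ T ∧ Dominant p (insert e T)) ↔ e = e₁ ∨ e = e₂ := by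
  choose m hmT hmin using fun j => T.exists_min_image (p j) hne
  have hsurj : ∀ t ∈ T, ∃ j, m j = t := fun t ht => by
    obtain ⟨j, hj⟩ := hT t
    exact ⟨j, hp j (le_antisymm (hmin j t ht) (hj _ (hmT j)))⟩
  -- `m` maps the rankings onto `T`, which has one element fewer, so exactly one pair of rankings
  -- shares its minimum. A completing element becomes the minimum of one of these two: hence two
  -- completions.
  obtain ⟨j₁, -, j₂, -, hj, hm⟩ := Finset.exists_ne_map_eq_of_card_lt_of_maps_to
    (s := (Finset.univ : Finset I)) (t := T) (f := m) (by rw [Finset.card_univ]; omega)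
    (fun j _ => hmT j)
  have himg : ∀ j₁ j₂ : I, j₁ ≠ j₂ → m j₁ = m j₂ → (Finset.univ.erase j₁).image m = T := by
    intro j₁ j₂ hj hm
    ext t
    simp only [Finset.mem_image, Finset.mem_erase, Finset.mem_univ, and_true]
    constructor
    · rintro ⟨j, -, rfl⟩
      exact hmT j
    · intro ht
      obtain ⟨j, rfl⟩ := hsurj t ht
      by_cases h : j = j₁
      · exact ⟨j₂, hj.symm, by rw [h, hm]⟩
      · exact ⟨j, h, rfl⟩
  have hinj : ∀ j₁ j₂ : I, j₁ ≠ j₂ → m j₁ = m j₂ → ∀ i ≠ j₁, ∀ j ≠ j₁, m i = m j → i = j := by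
    intro j₁ j₂ hj hm i hi j hj' hij
    have h : ((Finset.univ.erase j₁).image m).card = (Finset.univ.erase j₁).card := by
      rw [himg j₁ j₂ hj hm, Finset.card_erase_of_mem (Finset.mem_univ _), Finset.card_univ]
      omega
    exact Finset.card_image_iff.1 h (by simpa using hi) (by simpa using hj') hij
  have key : ∀ j₁ j₂ : I, j₁ ≠ j₂ → m j₁ = m j₂ → ∃ e, (∀ i ≠ j₁, p i (m i) < p i e) ∧
      p j₁ e < p j₁ (m j₁) ∧ (e ∉ T ∧ Dominant p (insert e T)) ∧
      ∀ e', (∀ i ≠ j₁, p i (m i) < p i e') → Dominant p (insert e' T) → e' = e := by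
    intro j₁ j₂ hj hm
    obtain ⟨e, he, hmax⟩ := (Finset.univ.filter fun e => ∀ i ≠ j₁, p i (m i) < p i e).exists_max_image
      (p j₁) (by
        obtain ⟨e, he⟩ := hA j₁
        refine ⟨e, Finset.mem_filter.2 ⟨Finset.mem_univ _, fun i hi => ?_⟩⟩
        obtain ⟨t, ht, hte⟩ := he i hi
        exact (hmin i t ht).trans_lt hte)
    simp only [Finset.mem_filter, Finset.mem_univ, true_and] at he hmax
    have hlow : ∀ e, (∀ i ≠ j₁, p i (m i) < p i e) → p j₁ e < p j₁ (m j₁) := by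
      intro e he
      obtain ⟨j, hje⟩ := hT e
      have : j = j₁ := by
        by_contra h
        exact absurd (hje _ (hmT j)) (not_le.2 (he j h))
      subst this
      refine lt_of_le_of_ne (hje _ (hmT j)) fun h => ?_
      have h1 := he j₂ hj.symm
      rw [hp j h, hm] at h1
      exact lt_irrefl _ h1
    refine ⟨e, he, hlow e he, ⟨fun heT => ?_, fun x => ?_⟩, fun e' he' hdom => ?_⟩
    · exact absurd (hmin j₁ e heT) (not_le.2 (hlow e he))
    · by_cases hx : ∀ i ≠ j₁, p i (m i) < p i x
      · refine ⟨j₁, fun s hs => ?_⟩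
        rcases Finset.mem_insert.1 hs with rfl | hs
        · exact hmax x hx
        · exact (hlow x hx).le.trans (hmin j₁ s hs)
      · push Not at hx
        obtain ⟨i, hi, hxi⟩ := hx
        refine ⟨i, fun s hs => ?_⟩
        rcases Finset.mem_insert.1 hs with rfl | hs
        · exact hxi.trans (he i hi).le
        · exact hxi.trans (hmin i s hs)
    · obtain ⟨j, hje⟩ := hdom e
      have : j = j₁ := by
        by_contra h
        exact absurd (hje _ (Finset.mem_insert_of_mem (hmT j))) (not_le.2 (he j h))
      subst this
      exact hp j (le_antisymm (hmax e' he') (hje _ (Finset.mem_insert_self _ _)))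
  obtain ⟨e₁, h1, h1', h1d, h1u⟩ := key j₁ j₂ hj hm
  obtain ⟨e₂, h2, h2', h2d, h2u⟩ := key j₂ j₁ hj.symm hm.symm
  refine ⟨e₁, e₂, ?_, fun e => ⟨fun ⟨heT, hdom⟩ => ?_, ?_⟩⟩
  · rintro rfl
    exact lt_asymm h1' (h2 j₁ hj)
  · have hm' : ∀ t ∈ T, ∃ i, m i = t ∧ p i (m i) < p i e := fun t ht => by
      obtain ⟨i, hi⟩ := hdom t
      have : m i = t := hp i (le_antisymm (hmin i t ht) (hi _ (Finset.mem_insert_of_mem (hmT i))))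
      refine ⟨i, this, lt_of_le_of_ne (this ▸ hi _ (Finset.mem_insert_self _ _)) fun h => heT ?_⟩
      rw [← hp i h]
      exact hmT i
    obtain ⟨i₀, hi₀, hlt⟩ := hm' _ (hmT j₁)
    have hother : ∀ i, i ≠ j₁ → i ≠ j₂ → p i (m i) < p i e := by
      intro i hi1 hi2
      obtain ⟨i', hi', hlt'⟩ := hm' _ (hmT i)
      have : i' ≠ j₁ := by
        rintro rfl
        exact hi2 (hinj _ _ hj hm _ hi1 _ hj.symm (hi'.symm.trans hm))
      rwa [← hinj _ _ hj hm _ this _ hi1 hi']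
    have : i₀ = j₁ ∨ i₀ = j₂ := by
      by_contra h
      push Not at h
      exact h.2 (hinj _ _ hj hm _ h.1 _ hj.symm (hi₀.trans hm))
    rcases this with rfl | rfl
    · exact Or.inr (h2u e (fun i hi => if h : i = i₀ then h ▸ hlt else hother i h hi) hdom)
    · exact Or.inl (h1u e (fun i hi => if h : i = i₀ then h ▸ hlt else hother i hi h) hdom)
  · rintro (rfl | rfl)
    · exact h1d
    · exact h2d

end Dominant

/-- If the colours of `S` are not all distinct, an even number of facets of `S` carry
all the colours but `i₀`. -/
theorem even_card_facets_of_image_ne_univ {E I : Type*} [DecidableEq E] [Fintype I]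
    [DecidableEq I] (c : E → I) (i₀ : I) {S : Finset E} (hS : S.card = Fintype.card I)
    (hc : S.image c ≠ Finset.univ) (P : Finset (Finset E))
    (hP : ∀ T, T ∈ P ↔ T ⊆ S ∧ T.card + 1 = Fintype.card I ∧
      T.image c = Finset.univ.erase i₀) : Even P.card := by
  rcases P.eq_empty_or_nonempty with rfl | ⟨T, hT⟩
  · simp
  obtain ⟨hTS, hTc, hTi⟩ := (hP T).1 hT
  obtain ⟨e, heT, rfl⟩ := Finset.exists_eq_insert_iff.2 ⟨hTS, hTc.trans hS.symm⟩
  have hinj : Set.InjOn c T := Finset.card_image_iff.1 (by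
    rw [hTi, Finset.card_erase_of_mem (Finset.mem_univ _), Finset.card_univ]; omega)
  have hce : c e ≠ i₀ := fun h => hc (by
    rw [Finset.image_insert, hTi, h, Finset.insert_erase (Finset.mem_univ _)])
  -- The colour of `e` is repeated by exactly one `e'` in `T`; swapping the two gives the only other
  -- such facet.
  obtain ⟨e', he'T, he'⟩ : ∃ e' ∈ T, c e' = c e := by
    rw [← Finset.mem_image, hTi]; simpa using hce
  have hne : e ≠ e' := fun h => heT (h ▸ he'T)
  have hcI : (insert e (T.erase e')).image c = Finset.univ.erase i₀ := by
    rw [Finset.image_insert, ← he', ← Finset.image_insert, Finset.insert_erase he'T, hTi]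
  have hne' : T ≠ insert e (T.erase e') := fun h => heT (h ▸ Finset.mem_insert_self _ _)
  have hcI' : (insert e (T.erase e')).card = T.card := by
    rw [Finset.card_insert_of_notMem (by simp [heT]), Finset.card_erase_add_one he'T]
  suffices P = {T, insert e (T.erase e')} by
    rw [this, Finset.card_pair hne']; exact even_two
  ext U
  rw [hP, Finset.mem_insert, Finset.mem_singleton]
  constructor
  · rintro ⟨hU, hUc, hUi⟩
    have hUinj : Set.InjOn c U := Finset.card_image_iff.1 (by
      rw [hUi, Finset.card_erase_of_mem (Finset.mem_univ _), Finset.card_univ]; omega)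
    by_cases heU : e ∈ U
    · right
      refine Finset.eq_of_subset_of_card_le (fun u hu => ?_) (by omega)
      rcases Finset.mem_insert.1 (hU hu) with rfl | huT
      · simp
      · refine Finset.mem_insert_of_mem (Finset.mem_erase.2 ⟨fun h => hne ?_, huT⟩)
        exact hUinj heU (h ▸ hu) he'.symm
    · left
      refine Finset.eq_of_subset_of_card_le (fun u hu => ?_) (by omega)
      rcases Finset.mem_insert.1 (hU hu) with rfl | huT
      · exact absurd hu heU
      · exact huT
  · rintro (rfl | rfl)
    · exact ⟨Finset.subset_insert _ _, hTc, hTi⟩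
    · exact ⟨Finset.insert_subset_insert _ (Finset.erase_subset _ _), by omega, hcI⟩

/-- **Scarf's lemma** for a colouring: the slack element `inr i` is last in the
ranking `i` and ahead of all proper elements in the others. -/
theorem exists_dominant_image_eq_univ {X I L : Type*} [Fintype X] [Nonempty X] [Fintype I]
    [Nonempty I] [DecidableEq X] [DecidableEq I] [LinearOrder L] {p : I → X ⊕ I → L}
    (hp : ∀ j, Function.Injective (p j))
    (hbot : ∀ j x, p j (Sum.inr j) < p j (Sum.inl x))
    (htop : ∀ i j x, i ≠ j → p j (Sum.inl x) < p j (Sum.inr i)) (c : X → I) :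
    ∃ S : Finset (X ⊕ I), Dominant p S ∧ S.card = Fintype.card I ∧
      S.image (Sum.elim c id) = Finset.univ := by
  classical
  by_contra! hno
  obtain ⟨i₀⟩ := ‹Nonempty I›
  set c' : X ⊕ I → I := Sum.elim c id
  have hbot' : ∀ j e, p j (Sum.inr j) ≤ p j e := by
    rintro j (x | i)
    · exact (hbot j x).le
    · rcases eq_or_ne i j with rfl | h
      · exact le_rfl
      · exact ((hbot j (Classical.arbitrary X)).trans (htop i j _ h)).le
  set rooms : Finset (Finset (X ⊕ I)) :=
    Finset.univ.filter fun S => Dominant p S ∧ S.card = Fintype.card I with hrooms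
  set doors : Finset (Finset (X ⊕ I)) :=
    Finset.univ.filter fun T => Dominant p T ∧ T.card + 1 = Fintype.card I ∧
      T.image c' = Finset.univ.erase i₀ with hdoors
  -- Pairs door ⊆ room are counted twice. Without a fully coloured room, each room has evenly many
  -- doors; each door opens into two rooms, except `T₀`, which opens into one.
  have hcount := Finset.sum_card_bipartiteAbove_eq_sum_card_bipartiteBelow
    (s := rooms) (t := doors) (fun S T => T ⊆ S)
  have hleft : Even (∑ S ∈ rooms, (doors.bipartiteAbove (fun S T => T ⊆ S) S).card) := by
    refine Finset.even_sum _ fun S hS => ?_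
    simp only [hrooms, Finset.mem_filter, Finset.mem_univ, true_and] at hS
    refine even_card_facets_of_image_ne_univ c' i₀ hS.2 (hno S hS.1 hS.2) _ fun T => ?_
    simp only [Finset.mem_bipartiteAbove, hdoors, Finset.mem_filter, Finset.mem_univ, true_and]
    exact ⟨fun h => ⟨h.2, h.1.2⟩, fun h => ⟨⟨hS.1.mono h.1, h.2⟩, h.1⟩⟩
  set T₀ : Finset (X ⊕ I) := (Finset.univ.erase i₀).image Sum.inr with hT₀
  have hT₀mem : ∀ i, Sum.inr i ∈ T₀ ↔ i ≠ i₀ := by simp [hT₀]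
  have hT₀mem' : ∀ x, Sum.inl x ∉ T₀ := by simp [hT₀]
  obtain ⟨x₀, -, hx₀⟩ := (Finset.univ : Finset X).exists_max_image (fun x => p i₀ (Sum.inl x))
    Finset.univ_nonempty
  have hdom₀ : Dominant p (insert (Sum.inl x₀) T₀) := by
    rintro (x | i)
    · refine ⟨i₀, fun s hs => ?_⟩
      rcases Finset.mem_insert.1 hs with rfl | hs
      · exact hx₀ x (Finset.mem_univ _)
      · rcases s with y | i
        · exact absurd hs (hT₀mem' y)
        · exact (htop i i₀ x ((hT₀mem i).1 hs)).le
    · exact ⟨i, fun s _ => hbot' i s⟩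
  have hT₀card : T₀.card + 1 = Fintype.card I := by
    rw [hT₀, Finset.card_image_of_injective _ Sum.inr_injective,
      Finset.card_erase_add_one (Finset.mem_univ _), Finset.card_univ]
  have hT₀door : T₀ ∈ doors := by
    simp only [hdoors, Finset.mem_filter, Finset.mem_univ, true_and]
    refine ⟨hdom₀.mono (Finset.subset_insert _ _), hT₀card, ?_⟩
    rw [hT₀, Finset.image_image]
    exact Finset.image_id
  have hone : (rooms.bipartiteBelow (fun S T => T ⊆ S) T₀).card = 1 := by
    rw [Finset.card_eq_one]
    refine ⟨insert (Sum.inl x₀) T₀, ?_⟩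
    ext S
    simp only [Finset.mem_bipartiteBelow, hrooms, Finset.mem_filter, Finset.mem_univ, true_and,
      Finset.mem_singleton]
    constructor
    · rintro ⟨⟨hS, hSc⟩, hsub⟩
      obtain ⟨e, heT, rfl⟩ := Finset.exists_eq_insert_iff.2 ⟨hsub, hT₀card.trans hSc.symm⟩
      obtain ⟨j, hj⟩ := hS (Sum.inl x₀)
      have hji : j = i₀ := by
        by_contra h
        exact absurd (hj _ (Finset.mem_insert_of_mem ((hT₀mem j).2 h))) (not_le.2 (hbot j x₀))
      subst hji
      have he := hj e (Finset.mem_insert_self _ _)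
      rcases e with x | i
      · rw [Sum.inl_injective (hp j (le_antisymm (hx₀ x (Finset.mem_univ _)) he))]
      · have : i = j := by simpa [hT₀mem] using heT
        exact absurd he (not_le.2 (this ▸ hbot i x₀))
    · rintro rfl
      refine ⟨⟨hdom₀, ?_⟩, Finset.subset_insert _ _⟩
      rw [Finset.card_insert_of_notMem (hT₀mem' x₀), hT₀card]
  have hright : Even (∑ T ∈ doors.erase T₀,
      (rooms.bipartiteBelow (fun S T => T ⊆ S) T).card) := by
    refine Finset.even_sum _ fun T hT => ?_
    simp only [hdoors, Finset.mem_erase, Finset.mem_filter, Finset.mem_univ, true_and] at hT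
    obtain ⟨hTne, hTd, hTc, hTi⟩ := hT
    obtain ⟨x, hx⟩ : ∃ x, Sum.inl x ∈ T := by
      by_contra! h
      refine hTne (Finset.eq_of_subset_of_card_le (fun e he => ?_) (by omega))
      rcases e with y | i
      · exact absurd he (h y)
      · have := Finset.mem_image_of_mem c' he
        rw [hTi] at this
        exact (hT₀mem i).2 (Finset.ne_of_mem_erase this)
    obtain ⟨e₁, e₂, hne, he⟩ := hTd.exists_two_completions hp ⟨_, hx⟩ hTc fun j =>
      ⟨Sum.inr j, fun i hi => ⟨_, hx, htop j i x hi.symm⟩⟩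
    have h1 := (he e₁).2 (Or.inl rfl)
    have h2 := (he e₂).2 (Or.inr rfl)
    suffices rooms.bipartiteBelow (fun S T => T ⊆ S) T = {insert e₁ T, insert e₂ T} by
      rw [this, Finset.card_pair]
      · exact even_two
      · intro h
        have : e₁ ∈ insert e₂ T := h ▸ Finset.mem_insert_self _ _
        rcases Finset.mem_insert.1 this with h | h
        · exact hne h
        · exact h1.1 h
    ext S
    simp only [Finset.mem_bipartiteBelow, hrooms, Finset.mem_filter, Finset.mem_univ, true_and,
      Finset.mem_insert, Finset.mem_singleton]
    constructor
    · rintro ⟨⟨hS, hSc⟩, hsub⟩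
      obtain ⟨e, heT, rfl⟩ := Finset.exists_eq_insert_iff.2 ⟨hsub, hTc.trans hSc.symm⟩
      exact ((he e).1 ⟨heT, hS⟩).imp (fun h => by rw [h]) (fun h => by rw [h])
    · rintro (rfl | rfl)
      · exact ⟨⟨h1.2, by rw [Finset.card_insert_of_notMem h1.1, hTc]⟩, Finset.subset_insert _ _⟩
      · exact ⟨⟨h2.2, by rw [Finset.card_insert_of_notMem h2.1, hTc]⟩, Finset.subset_insert _ _⟩
  rw [hcount, ← Finset.add_sum_erase _ _ hT₀door, hone] at hleft
  exact (Nat.not_even_iff_odd.2 (hright.one_add)) hleft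

/-! ### From Scarf's lemma to the KKM theorem -/

/-- A colouring of the lattice points of a dilated simplex has a lattice point near which every
colour occurs, apart from colours whose coordinate is small there. -/
theorem exists_piAntidiag_near_colours {I : Type*} [Fintype I] [Nonempty I] [DecidableEq I]
    (N : ℕ) (c : ↥(Finset.piAntidiag (Finset.univ : Finset I) N) → I) :
    ∃ a : ↥(Finset.piAntidiag (Finset.univ : Finset I) N), ∀ i,
      (∃ y, c y = i ∧ ∀ j, y.1 j ≤ a.1 j + Fintype.card I ∧ a.1 j ≤ y.1 j + Fintype.card I) ∨
      a.1 i ≤ Fintype.card I := by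
  classical
  let X := ↥(Finset.piAntidiag (Finset.univ : Finset I) N)
  have hsum : ∀ x : X, ∑ i, x.1 i = N := fun x => (Finset.mem_piAntidiag.1 x.2).1
  have hle : ∀ (x : X) i, x.1 i ≤ N := fun x i =>
    (Finset.single_le_sum (f := x.1) (fun _ _ => Nat.zero_le _) (Finset.mem_univ i)).trans_eq (hsum x)
  have : Nonempty X := ⟨⟨Pi.single (Classical.arbitrary I) N, by simp [Finset.mem_piAntidiag]⟩⟩
  -- The shift by 1 leaves 0 free for slack `j`, and `N + 2` exceeds every proper weight. Ties are
  -- broken by an enumeration.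
  let w : I → X ⊕ I → ℕ := fun j => Sum.elim (fun x => x.1 j + 1) fun i => if i = j then 0 else N + 2
  let p : I → X ⊕ I → ℕ ×ₗ ℕ := fun j s => toLex (w j s, (Fintype.equivFin (X ⊕ I) s : ℕ))
  have hplt : ∀ j s t, w j s < w j t → p j s < p j t := fun j s t h => Prod.Lex.toLex_lt_toLex.2 (Or.inl h)
  have hple : ∀ j s t, p j s ≤ p j t → w j s ≤ w j t := fun j s t h =>
    not_lt.1 fun h' => absurd h (not_le.2 (hplt j t s h'))
  have hbot : ∀ j x, p j (Sum.inr j) < p j (Sum.inl x) := fun j x => hplt _ _ _ (by simp [w])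
  have htop : ∀ i j x, i ≠ j → p j (Sum.inl x) < p j (Sum.inr i) := fun i j x h =>
    hplt _ _ _ (by have := hle x j; simp [w, h]; omega)
  have hp : ∀ j, Function.Injective (p j) := fun j s t h =>
    (Fintype.equivFin (X ⊕ I)).injective (Fin.val_injective (congrArg (fun q => (ofLex q).2) h))
  obtain ⟨S, hS, -, hSc⟩ := exists_dominant_image_eq_univ hp hbot htop c
  have hcol : ∀ j, Sum.inr j ∉ S → ∃ y, Sum.inl y ∈ S ∧ c y = j := by
    intro j hj
    obtain ⟨s, hs, hsj⟩ := Finset.mem_image.1 (hSc ▸ Finset.mem_univ j)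
    rcases s with y | i
    · exact ⟨y, hs, hsj⟩
    · exact absurd ((show i = j from hsj) ▸ hs) hj
  have hdom : ∀ x : X, ∃ j, Sum.inr j ∉ S ∧ ∀ y, Sum.inl y ∈ S → x.1 j ≤ y.1 j := by
    intro x
    obtain ⟨j, hj⟩ := hS (Sum.inl x)
    refine ⟨j, fun h => absurd (hj _ h) (not_le.2 (hbot j x)), fun y hy => ?_⟩
    simpa [w] using hple _ _ _ (hj _ hy)
  obtain ⟨j₀, hj₀, -⟩ := hdom (Classical.arbitrary X)
  obtain ⟨a, ha, -⟩ := hcol j₀ hj₀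
  set J : Finset I := Finset.univ.filter fun j => Sum.inr j ∉ S with hJ
  have hJmem : ∀ j, j ∈ J ↔ Sum.inr j ∉ S := by simp [hJ]
  have hJcard : J.card ≤ Fintype.card I := Finset.card_le_univ _
  choose b hb hbmin using fun j =>
    (Finset.univ.filter fun y : X => Sum.inl y ∈ S).exists_min_image (fun y => y.1 j) ⟨a, by simpa using ha⟩
  simp only [Finset.mem_filter, Finset.mem_univ, true_and] at hb hbmin
  -- Otherwise some lattice point exceeds the minima of `S` in every coordinate of `J`, against
  -- dominance. So the points of `S` have little room above these minima, and little mass outside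
  -- `J`.
  have hbig : N < ∑ j ∈ J, (b j).1 j + J.card := by
    by_contra! h
    set x : I → ℕ := fun i => (if i ∈ J then (b i).1 i + 1 else 0) +
      if i = j₀ then N - (∑ j ∈ J, (b j).1 j + J.card) else 0 with hx
    have hxs : ∑ i, x i = N := by
      simp only [hx, Finset.sum_add_distrib, Finset.sum_ite_mem, Finset.univ_inter,
        Finset.sum_ite_eq', Finset.mem_univ, if_true, Finset.sum_const, smul_eq_mul, mul_one]
      omega
    obtain ⟨j, hj, hle⟩ := hdom ⟨x, by simp [Finset.mem_piAntidiag, hxs]⟩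
    have h1 := hle _ (hb j)
    simp only [hx, (hJmem j).2 hj, if_true] at h1
    omega
  have hJsum : ∀ y : X, ∑ j ∈ J, y.1 j + ∑ j ∈ Jᶜ, y.1 j = N := fun y => by
    rw [Finset.sum_add_sum_compl, hsum]
  have hout : ∀ y, Sum.inl y ∈ S → ∀ i ∉ J, y.1 i ≤ Fintype.card I := by
    intro y hy i hi
    have h1 : ∑ j ∈ J, (b j).1 j ≤ ∑ j ∈ J, y.1 j := Finset.sum_le_sum fun j _ => hbmin j y hy
    have h2 : y.1 i ≤ ∑ j ∈ Jᶜ, y.1 j :=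
      Finset.single_le_sum (f := y.1) (fun _ _ => Nat.zero_le _) (Finset.mem_compl.2 hi)
    have := hJsum y
    omega
  have hin : ∀ y, Sum.inl y ∈ S → ∀ i ∈ J, y.1 i ≤ (b i).1 i + Fintype.card I := by
    intro y hy i hi
    have h1 : ∑ j ∈ J.erase i, (b j).1 j ≤ ∑ j ∈ J.erase i, y.1 j :=
      Finset.sum_le_sum fun j _ => hbmin j y hy
    have h2 := Finset.add_sum_erase J (fun j => (b j).1 j) hi
    have h3 := Finset.add_sum_erase J y.1 hi
    have := hJsum y
    omega
  refine ⟨a, fun i => ?_⟩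
  by_cases hi : i ∈ J
  · obtain ⟨y, hy, hyc⟩ := hcol i ((hJmem i).1 hi)
    refine Or.inl ⟨y, hyc, fun j => ?_⟩
    by_cases hj : j ∈ J
    · have := hin y hy j hj
      have := hin a ha j hj
      have := hbmin j y hy
      have := hbmin j a ha
      omega
    · have := hout y hy j hj
      have := hout a ha j hj
      omega
  · exact Or.inr (hout a ha i hi)

/-- A closed cover of the standard simplex whose `i`-th member contains the `i`-th facet has a
common point. -/
theorem exists_mem_forall_of_facet_subset {I : Type*} [Fintype I] [Nonempty I]
    {H : I → Set (I → ℝ)} (hH : ∀ i, IsClosed (H i))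
    (hcover : ∀ x ∈ stdSimplex ℝ I, ∃ i, x ∈ H i)
    (hfacet : ∀ x ∈ stdSimplex ℝ I, ∀ i, x i = 0 → x ∈ H i) :
    ∃ x ∈ stdSimplex ℝ I, ∀ i, x ∈ H i := by
  classical
  let u : ∀ N : ℕ, ↥(Finset.piAntidiag (Finset.univ : Finset I) (N + 1)) → I → ℝ :=
    fun N y i => y.1 i / ((N + 1 : ℕ) : ℝ)
  have hpos : ∀ N : ℕ, (0 : ℝ) < ((N + 1 : ℕ) : ℝ) := fun N => by positivity
  have hu : ∀ N y, u N y ∈ stdSimplex ℝ I := by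
    refine fun N y => ⟨fun i => by positivity, ?_⟩
    have h : ∑ i, y.1 i = N + 1 := (Finset.mem_piAntidiag.1 y.2).1
    rw [← Finset.sum_div, ← Nat.cast_sum, h, div_self (hpos N).ne']
  choose c hc using fun N y => hcover (u N y) (hu N y)
  choose a ha using fun N => exists_piAntidiag_near_colours (N + 1) (c N)
  obtain ⟨x, hx, φ, hφ, hlim⟩ := (isCompact_stdSimplex ℝ I).tendsto_subseq fun N => hu N (a N)
  refine ⟨x, hx, fun i => ?_⟩
  by_contra hxi
  have hxi0 : 0 < x i := lt_of_le_of_ne (hx.1 i) fun h => hxi (hfacet x hx i h.symm)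
  obtain ⟨ε, hε, hball⟩ := Metric.isOpen_iff.1 (hH i).isOpen_compl x hxi
  -- Within `δ` of `x`, coordinate `i` cannot be small and no point lies in `H i`, so both
  -- alternatives for colour `i` fail.
  set δ := min ε (x i)
  have hδ : 0 < δ := lt_min hε hxi0
  have hsmall : Filter.Tendsto (fun n => (Fintype.card I : ℝ) / ((φ n + 1 : ℕ) : ℝ))
      Filter.atTop (nhds 0) :=
    (tendsto_const_div_atTop_nhds_zero_nat _).comp
      ((Filter.tendsto_add_atTop_nat 1).comp hφ.tendsto_atTop)
  obtain ⟨n, hn1, hn2⟩ := ((Metric.tendsto_nhds.1 hlim (δ / 2) (half_pos hδ)).and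
    (hsmall.eventually_lt_const (half_pos hδ))).exists
  simp only [Function.comp_apply] at hn1
  rcases ha (φ n) i with ⟨y, hy, hya⟩ | hai
  · refine hball (a := u (φ n) y) ?_ (hy ▸ hc (φ n) y)
    have h1 : dist (u (φ n) y) (u (φ n) (a (φ n))) ≤ (Fintype.card I : ℝ) / ((φ n + 1 : ℕ) : ℝ) := by
      refine (dist_pi_le_iff (by positivity)).2 fun j => ?_
      have h2 : (y.1 j : ℝ) ≤ (a (φ n)).1 j + Fintype.card I := by exact_mod_cast (hya j).1
      have h3 : ((a (φ n)).1 j : ℝ) ≤ y.1 j + Fintype.card I := by exact_mod_cast (hya j).2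
      rw [Real.dist_eq, ← sub_div, abs_div, abs_of_pos (hpos _)]
      gcongr
      exact abs_le.2 ⟨by linarith, by linarith⟩
    have := dist_triangle (u (φ n) y) (u (φ n) (a (φ n))) x
    exact Metric.mem_ball.2 (lt_of_lt_of_le (by linarith) (min_le_left ε (x i)))
  · have h1 : u (φ n) (a (φ n)) i ≤ (Fintype.card I : ℝ) / ((φ n + 1 : ℕ) : ℝ) := by
      have : ((a (φ n)).1 i : ℝ) ≤ Fintype.card I := by exact_mod_cast hai
      exact div_le_div_of_nonneg_right this (hpos _).le
    have h2 := (dist_le_pi_dist (u (φ n) (a (φ n))) x i).trans_lt hn1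
    have h3 := neg_abs_le (u (φ n) (a (φ n)) i - x i)
    rw [Real.dist_eq] at h2
    linarith [min_le_right ε (x i)]

/-- The **Knaster–Kuratowski–Mazurkiewicz theorem** on the standard simplex. -/
theorem exists_mem_forall_of_kkm {I : Type*} [Fintype I] [Nonempty I]
    {F : I → Set (I → ℝ)} (hF : ∀ i, IsClosed (F i))
    (hcover : ∀ x ∈ stdSimplex ℝ I, ∃ i, 0 < x i ∧ x ∈ F i) :
    ∃ x ∈ stdSimplex ℝ I, ∀ i, x ∈ F i := by
  classical
  have hne : ∀ i, (F i).Nonempty := fun i => by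
    obtain ⟨j, hj, hjF⟩ := hcover _ (single_mem_stdSimplex ℝ i)
    have : j = i := by
      by_contra h
      simp [h] at hj
    exact ⟨_, this ▸ hjF⟩
  let g : I → (I → ℝ) → ℝ := fun i x => Metric.infDist x (F i)
  have hg : ∀ i, Continuous (g i) := fun i => Metric.continuous_infDist_pt _
  have hg0 : ∀ i x, 0 ≤ g i x := fun i x => Metric.infDist_nonneg
  -- Since the `x i` sum to 1, not every `g i x` is below its share `x i * ∑ j, g j x`, so these
  -- sets cover. At a common point, one `g j x = 0` with `x j > 0` forces all distances to vanish.
  obtain ⟨x, hx, hxH⟩ := exists_mem_forall_of_facet_subset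
    (H := fun i => {x | x i * ∑ j, g j x ≤ g i x})
    (fun i => isClosed_le ((continuous_apply i).mul (continuous_finsetSum _ fun j _ => hg j)) (hg i))
    (fun x hx => by
      by_contra! h
      simp only [Set.mem_ofPred_eq, not_le] at h
      have h1 := Finset.sum_lt_sum_of_nonempty Finset.univ_nonempty fun i (_ : i ∈ Finset.univ) => h i
      rw [← Finset.sum_mul, hx.2, one_mul] at h1
      exact lt_irrefl _ h1)
    (fun x _ i hi => by simpa [hi] using hg0 i x)
  refine ⟨x, hx, fun i => ?_⟩
  obtain ⟨j, hj, hjF⟩ := hcover x hx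
  have hgj : g j x = 0 := Metric.infDist_zero_of_mem hjF
  have hG : ∑ i, g i x = 0 := by
    have h1 : x j * ∑ i, g i x ≤ 0 := hgj ▸ hxH j
    exact le_antisymm (nonpos_of_mul_nonpos_right h1 hj) (Finset.sum_nonneg fun i _ => hg0 i x)
  have hgi := (Finset.sum_eq_zero_iff_of_nonneg fun i _ => hg0 i x).1 hG i (Finset.mem_univ i)
  exact ((hF i).mem_iff_infDist_zero (hne i)).2 hgi

/-! ### Segment-density, support functions and separation -/

/-- The right-hand side is itself convex: approximate two of its points from `convexHull ℝ S ∩ U`,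
then use density on the segment joining the approximants. -/
theorem IsSelfSegmentDense.convexHull_subset_closure {X : Type*} [AddCommGroup X] [Module ℝ X]
    [TopologicalSpace X] [ContinuousAdd X] [ContinuousConstSMul ℝ X] {U V S : Set X}
    (hU : IsSelfSegmentDense U V) (hS : S ⊆ U) :
    convexHull ℝ S ⊆ closure (convexHull ℝ S ∩ U) := by
  refine convexHull_min (fun x hx => subset_closure ⟨subset_convexHull ℝ S hx, hS hx⟩) ?_
  intro x hx y hy a b ha hb hab
  have hcont : Continuous fun q : X × X => a • q.1 + b • q.2 := by fun_prop
  have h := map_mem_closure₂ (f := fun x y => a • x + b • y) hcont hx hy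
    (u := closure (convexHull ℝ S ∩ U)) fun u hu v hv => ?_
  · rwa [closure_closure] at h
  · refine closure_mono (Set.inter_subset_inter_left _ ?_)
      (hU.segment_dense u hu.2 v hv.2 ⟨a, b, ha, hb, hab, rfl⟩)
    exact (convex_convexHull ℝ S).segment_subset hu.1 hv.1

theorem zero_le_supportFn_iff {n : ℕ} {A : Set (Fin n → ℝ)} (hA : IsCompact A)
    (hne : A.Nonempty) (y : Fin n → ℝ) : 0 ≤ supportFn A y ↔ ∃ z ∈ A, 0 ≤ z ⬝ᵥ y := by
  have hcont : Continuous fun z : Fin n → ℝ => z ⬝ᵥ y := by fun_prop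
  have hK := hA.image hcont
  constructor
  · intro h
    obtain ⟨z, hz, hzy⟩ := hK.sSup_mem (hne.image _)
    exact ⟨z, hz, h.trans_eq hzy.symm⟩
  · rintro ⟨z, hz, h⟩
    exact h.trans (le_csSup hK.bddAbove ⟨z, hz, rfl⟩)

theorem isClosed_setOf_exists_zero_le_dotProduct {n : ℕ} {A : Set (Fin n → ℝ)}
    (hA : IsCompact A) : IsClosed {y : Fin n → ℝ | ∃ z ∈ A, 0 ≤ z ⬝ᵥ y} := by
  have := isCompact_iff_compactSpace.1 hA
  have hcl : IsClosed {q : A × (Fin n → ℝ) | 0 ≤ q.1.1 ⬝ᵥ q.2} :=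
    isClosed_le continuous_const (by fun_prop)
  convert isClosedMap_snd_of_compactSpace _ hcl using 1
  ext y
  simp

/-- If a point of `A` has nonnegative value at a mixture of prices from `S`, then it has nonnegative
value at some price in `S`. -/
theorem exists_zero_le_dotProduct_of_mem_convexHull {n : ℕ} {A S : Set (Fin n → ℝ)}
    {x : Fin n → ℝ} (hx : x ∈ convexHull ℝ S) (h : ∃ z ∈ A, 0 ≤ z ⬝ᵥ x) :
    ∃ y ∈ S, ∃ z ∈ A, 0 ≤ z ⬝ᵥ y := by
  by_contra! hneg
  obtain ⟨z, hz, hzx⟩ := h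
  have hconv : Convex ℝ {y : Fin n → ℝ | z ⬝ᵥ y < 0} :=
    convex_halfSpace_lt ⟨dotProduct_add z, fun c y => dotProduct_smul c z y⟩ 0
  exact absurd hzx (not_le.2 (convexHull_min (fun y hy => hneg y hy z hz) hconv hx))

/-- A compact convex set whose support function is nonnegative on the price simplex meets the
nonnegative orthant. -/
theorem inter_nonneg_nonempty_of_forall_stdSimplex {n : ℕ} {A : Set (Fin n → ℝ)}
    (hne : A.Nonempty) (hA : IsCompact A) (hconv : Convex ℝ A)
    (h : ∀ y ∈ stdSimplex ℝ (Fin n), ∃ z ∈ A, 0 ≤ z ⬝ᵥ y) :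
    (A ∩ {z | ∀ i, 0 ≤ z i}).Nonempty := by
  by_contra hdis
  have hset : {z : Fin n → ℝ | ∀ i, 0 ≤ z i} = Set.Ici 0 := by
    ext z
    simp [Pi.le_def]
  rw [Set.not_nonempty_iff_eq_empty, ← Set.disjoint_iff_inter_eq_empty, hset] at hdis
  obtain ⟨f, u, v, hfu, huv, hfv⟩ :=
    geometric_hahn_banach_compact_closed hconv hA (convex_Ici 0) isClosed_Ici hdis
  have hv0 : v < 0 := by simpa using hfv 0 (Set.mem_Ici.2 le_rfl)
  have hf : ∀ z : Fin n → ℝ, f z = z ⬝ᵥ fun i => f (Pi.single i 1) := fun z => by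
    conv_lhs => rw [pi_eq_sum_univ' z]
    simp [dotProduct]
  set w : Fin n → ℝ := fun i => f (Pi.single i 1) with hw
  have hw0 : ∀ i, 0 ≤ w i := by
    intro i
    by_contra! hi
    -- On this nonnegative multiple of the basis vector `f` takes exactly the value `v`, which it
    -- must exceed on the orthant.
    have h1 := hfv ((v / w i) • Pi.single i 1) (Set.mem_Ici.2 (by
      refine smul_nonneg (div_nonneg_of_nonpos hv0.le hi.le) ?_
      exact Pi.single_nonneg.2 zero_le_one))
    rw [map_smul, smul_eq_mul, ← show w i = f (Pi.single i 1) from rfl, div_mul_cancel₀ _ hi.ne] at h1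
    exact lt_irrefl _ h1
  have hfneg : ∀ z ∈ A, z ⬝ᵥ w < 0 := fun z hz => hf z ▸ (hfu z hz).trans (huv.trans hv0)
  have hsum : 0 < ∑ i, w i := by
    refine lt_of_le_of_ne (Finset.sum_nonneg fun i _ => hw0 i) fun hs => ?_
    obtain ⟨z, hz⟩ := hne
    have hw' : w = 0 := funext fun i =>
      (Finset.sum_eq_zero_iff_of_nonneg fun i _ => hw0 i).1 hs.symm i (Finset.mem_univ i)
    have := hfneg z hz
    rw [hw', dotProduct_zero] at this
    exact lt_irrefl _ this
  obtain ⟨z, hz, hzw⟩ := h ((∑ i, w i)⁻¹ • w) ⟨fun i => mul_nonneg (by positivity) (hw0 i), by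
    simp [← Finset.mul_sum, hsum.ne']⟩
  rw [dotProduct_smul, smul_eq_mul] at hzw
  exact absurd hzw (not_le.2 (mul_neg_of_pos_of_neg (inv_pos.2 hsum) (hfneg z hz)))

/-! ### The equilibrium theorem -/

theorem mainTheorem4 (n : ℕ) (hn : 1 ≤ n)
    (C : ↥(stdSimplex ℝ (Fin n)) → Set (Fin n → ℝ))
    (hC_nonempty : ∀ x, (C x).Nonempty)
    (hC_compact : ∀ x, IsCompact (C x))
    (hC_convex : ∀ x, Convex ℝ (C x))
    (D : Set (Fin n → ℝ))
    (hD : IsSelfSegmentDense D (stdSimplex ℝ (Fin n)))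
    (hC_usc : ∀ y ∈ D, UpperSemicontinuous fun x => supportFn (C x) y)
    (hWalras : ∀ x : ↥(stdSimplex ℝ (Fin n)),
      x.val ∈ D → 0 ≤ supportFn (C x) x.val) :
    ∃ x₀ : ↥(stdSimplex ℝ (Fin n)), (C x₀ ∩ {z | ∀ i, 0 ≤ z i}).Nonempty := by
  have hpos := fun x y => zero_le_supportFn_iff (hC_compact x) (hC_nonempty x) y
  let G : (Fin n → ℝ) → Set ↥(stdSimplex ℝ (Fin n)) := fun y => {x | 0 ≤ supportFn (C x) y}
  have hG : ∀ y ∈ D, IsClosed (G y) := fun y hy => (hC_usc y hy).isClosed_preimage 0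
  have hG' : ∀ y ∈ D, IsClosed (Subtype.val '' G y) := fun y hy =>
    (isClosed_stdSimplex ℝ (Fin n)).isClosedMap_subtype_val _ (hG y hy)
  have : CompactSpace ↥(stdSimplex ℝ (Fin n)) :=
    isCompact_iff_compactSpace.1 (isCompact_stdSimplex ℝ (Fin n))
  obtain ⟨x₀, -, hx₀⟩ := isCompact_univ.inter_iInter_nonempty (fun y : D => G y)
    (fun y => hG y y.2) fun s => by
      rcases s.eq_empty_or_nonempty with rfl | hs
      · exact ⟨⟨Pi.single ⟨0, hn⟩ 1, single_mem_stdSimplex ℝ _⟩, by simp⟩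
      have : Nonempty s := hs.to_subtype
      let y : s → Fin n → ℝ := fun i => i.1.1
      have hyD : ∀ i, y i ∈ D := fun i => i.1.2
      let comb : (s → ℝ) → Fin n → ℝ := fun t => ∑ i, t i • y i
      have hcomb : Continuous comb := by fun_prop
      -- KKM is applied in the simplex of weights, so the `y i` need not be affinely independent.
      obtain ⟨t, ht, htF⟩ := exists_mem_forall_of_kkm
        (F := fun i => comb ⁻¹' (Subtype.val '' G (y i)))
        (fun i => (hG' _ (hyD i)).preimage hcomb) fun t ht => by
          have hmem : comb t ∈ convexHull ℝ (y '' {i | 0 < t i}) := by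
            classical
            have h1 : comb t = ∑ i with 0 < t i, t i • y i := by
              refine (Finset.sum_filter_of_ne fun i _ hi => ?_).symm
              exact lt_of_le_of_ne (ht.1 i) fun h => hi (by rw [← h, zero_smul])
            have h2 : ∑ i with 0 < t i, t i = 1 := by
              rw [← ht.2]
              exact Finset.sum_filter_of_ne fun i _ hi => lt_of_le_of_ne (ht.1 i) hi.symm
            rw [h1]
            exact (convex_convexHull ℝ _).sum_mem (fun i _ => ht.1 i) h2 fun i hi =>
              subset_convexHull ℝ _ ⟨i, (Finset.mem_filter.1 hi).2, rfl⟩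
          have hclosed : IsClosed (⋃ i ∈ {i | 0 < t i}, Subtype.val '' G (y i)) :=
            (Set.toFinite _).isClosed_biUnion fun i _ => hG' _ (hyD i)
          have hsub : convexHull ℝ (y '' {i | 0 < t i}) ∩ D ⊆
              ⋃ i ∈ {i | 0 < t i}, Subtype.val '' G (y i) := by
            rintro x ⟨hx, hxD⟩
            have hxM := hD.subset hxD
            obtain ⟨_, ⟨i, hi, rfl⟩, hz⟩ := exists_zero_le_dotProduct_of_mem_convexHull hx
              ((hpos ⟨x, hxM⟩ x).1 (hWalras ⟨x, hxM⟩ hxD))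
            exact Set.mem_biUnion hi ⟨⟨x, hxM⟩, (hpos _ _).2 hz, rfl⟩
          have h := closure_minimal hsub hclosed (hD.convexHull_subset_closure
            (Set.image_subset_iff.2 fun i _ => hyD i) hmem)
          simpa using h
      obtain ⟨x, -, hx⟩ := htF (Classical.arbitrary s)
      refine ⟨x, Set.mem_univ _, Set.mem_iInter₂.2 fun y' hy' => ?_⟩
      obtain ⟨x', hx', hxx'⟩ := htF ⟨y', hy'⟩
      rwa [Subtype.ext (hxx'.trans hx.symm)] at hx'
  refine ⟨x₀, inter_nonneg_nonempty_of_forall_stdSimplex (hC_nonempty x₀) (hC_compact x₀)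
    (hC_convex x₀) fun y hy => ?_⟩
  refine closure_minimal (fun y hy => ?_)
    (isClosed_setOf_exists_zero_le_dotProduct (hC_compact x₀)) (hD.dense hy)
  exact (hpos x₀ y).1 (Set.mem_iInter.1 hx₀ ⟨y, hy⟩)
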